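/- Let $D>1$ be a squarefree integer and let $\mathcal O_K$ be the ring of integers of $K=\mathbb Q(\sqrt D)$. An element of $\mathcal O_K$ is totally positive if it and its conjugate are both positive, and a totally positive $\alpha\in\mathcal O_K$ is indecomposable if it is not the sum of two totally positive elements of $\mathcal O_K$. Write $N(\alpha)$ for the norm of $\alpha$ from $K$ to $\mathbb Q$, and let $-N$ be the largest negative integer that is the norm of an element of $\mathcal O_K$. Let $a$ be the smallest nonnegative integer such that $a^2\equiv D \pmod{4N}$ if $D\equiv 1\pmod 4$, and such that $a^2\equiv D\pmod N$ if $D\equiv 2,3\pmod 4$. Then every indecomposable $\alpha\in\mathcal O_K$ satisfies $$N(\alpha)<\frac{D-a^2}{4N}+\sqrt D \quad\text{if } D\equiv 1 \pmod 4,$$ $$N(\alpha)<\frac{D-a^2}{N}+2\sqrt D \quad\text{if } D\equiv 2,3 \pmod 4.$$ -/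

import Mathlib

open NumberField

/-- The field `ℚ(√D)`, as a subfield of `ℝ`. -/
noncomputable abbrev QSqrt (D : ℕ) : IntermediateField ℚ ℝ :=
  IntermediateField.adjoin ℚ {Real.sqrt (D : ℝ)}

/-- `ℚ(√D)` is a number field, so that the norms below are the usual ones. -/
instance QSqrt.instNumberField (D : ℕ) : NumberField (QSqrt D) where
  to_charZero := inferInstance
  to_finiteDimensional := by
    have h : IsIntegral ℚ (Real.sqrt (D : ℝ)) := by
      refine IsIntegral.of_pow (n := 2) (by norm_num) ?_
      rw [Real.sq_sqrt (Nat.cast_nonneg D), ← map_natCast (algebraMap ℚ ℝ) D]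
      exact isIntegral_algebraMap
    exact IntermediateField.adjoin.finiteDimensional h

/-- An algebraic integer `α` of a totally real field `K` is totally positive if all its conjugates
are positive (for a real quadratic field: `α` and `α'` are positive). -/
def IsTotallyPositive {K : Type*} [Field K] (α : 𝓞 K) : Prop :=
  ∀ σ : K →+* ℝ, 0 < σ (α : K)

/-- A totally positive algebraic integer is indecomposable if it is not a sum of two totally
positive algebraic integers. -/
def IsIndecomposableInteger {K : Type*} [Field K] (α : 𝓞 K) : Prop :=
  IsTotallyPositive α ∧
    ¬ ∃ β γ : 𝓞 K, IsTotallyPositive β ∧ IsTotallyPositive γ ∧ α = β + γ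

/-- The negative norms of algebraic integers of `K`. -/
def negativeNorms (K : Type*) [Field K] : Set ℤ :=
  {n : ℤ | n < 0 ∧ ∃ β : 𝓞 K, Algebra.norm ℤ β = n}

/-!
An indecomposable `α` is primitive in the lattice of integers of `ℚ(√D)`, so some `β` completes it
to a basis, and every `β + kα` does so too. Among these points one has conjugates of opposite signs:
otherwise a totally negative `γ` would be followed by a totally positive `γ + α`, and
`α = (γ + α) + (-γ)` would be decomposable (`IsIndecomposableInteger.exists_add_zsmul_mul_neg`).
Hence `β` can be chosen with `N(β) = -M < 0`, so `M ≥ N`. The form `N(xα + yβ)` has integral middle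
coefficient `t` and the discriminant `Δ` of the field, so that `t² + 4 N(α) M = Δ`
(`IsIndecomposableInteger.exists_norm_neg`).

If `M = N`, this equation makes `t` (or `t / 2` when `Δ = 4D`) a square root of `D` to the modulus
in the statement, so `a` is at most its absolute value and `N(α) ≤ (Δ - t²) / (4N)` gives the bound
even without the term in `√D`. If `M > N`, then `N(α) ≤ Δ / (4N)`, and what is lost is at
most `N / 4`, as `a ≤ N` (respectively `a ≤ N / 2`) by the symmetry of the set of square roots. Since
`⌊√D⌋ + √D` has negative norm, at least `-2√D`, one has `N ≤ 2√D`, and the loss is less than `√D`.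
-/

/-! ### Completing an indecomposable integer to a basis -/

section TwoEmbeddings

variable {K : Type*} [Field K]

/-- An indecomposable integer is primitive: if `α = gγ` with `g ≥ 2`, then `γ` is totally positive
and `α = γ + (g - 1)γ`. -/
theorem IsIndecomposableInteger.lt_two_of_eq_natCast_mul {α : 𝓞 K} (hα : IsIndecomposableInteger α) {g : ℕ}
    {γ : 𝓞 K} (h : α = g * γ) : g < 2 := by
  by_contra! hg
  have hγ : IsTotallyPositive γ := fun σ ↦ by
    have h1 := hα.1 σ
    rw [h] at h1
    push_cast at h1
    rw [map_mul, map_natCast] at h1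
    exact pos_of_mul_pos_right h1 (by positivity)
  refine hα.2 ⟨γ, (g - 1 : ℕ) * γ, hγ, fun σ ↦ ?_, ?_⟩
  · push_cast
    rw [map_mul, map_natCast]
    have : 0 < g - 1 := by omega
    have := hγ σ
    positivity
  · rw [h, Nat.cast_sub (by omega)]
    push_cast
    ring

variable {σ₁ σ₂ : K →+* ℝ}

/-- On the line `β + ℤα` through a lattice point `β` off `ℚα`, with `α` indecomposable, some point
has conjugates of opposite signs: otherwise the line would pass directly from a totally negative
point `γ` to the totally positive point `γ + α`, and `α = (γ + α) + (-γ)` would decompose. -/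
theorem IsIndecomposableInteger.exists_add_zsmul_mul_neg {α : 𝓞 K}
    (hα : IsIndecomposableInteger α) (hσ : ∀ σ : K →+* ℝ, σ = σ₁ ∨ σ = σ₂) {β : 𝓞 K}
    (hβ : σ₁ α * σ₂ β - σ₂ α * σ₁ β ≠ 0) :
    ∃ k : ℤ, σ₁ (β + k * α : 𝓞 K) * σ₂ (β + k * α : 𝓞 K) < 0 := by
  have h₁ := hα.1 σ₁
  have h₂ := hα.1 σ₂
  have hne : ∀ k : ℤ, β + k * α ≠ 0 := fun k h0 ↦ hβ <| by
    have : β = -(k * α) := eq_neg_of_add_eq_zero_left h0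
    rw [this]
    push_cast
    simp only [map_neg, map_mul, map_intCast]
    ring
  have hne' : ∀ (σ : K →+* ℝ) (k : ℤ), σ (β + k * α : 𝓞 K) ≠ 0 := fun σ k h0 ↦
    hne k <| RingOfIntegers.coe_eq_zero_iff.1 ((map_eq_zero σ).1 h0)
  have hval : ∀ (σ : K →+* ℝ) (k : ℤ), σ (β + k * α : 𝓞 K) = σ β + k * σ α := fun σ k ↦ by
    push_cast
    simp only [map_add, map_mul, map_intCast]
  set k : ℤ := ⌊-σ₁ β / σ₁ α⌋ with hk
  have hk₁ : σ₁ (β + k * α : 𝓞 K) < 0 := by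
    refine lt_of_le_of_ne ?_ (hne' σ₁ k)
    have := (le_div_iff₀ h₁).1 (Int.floor_le (-σ₁ β / σ₁ α))
    rw [hval]
    linarith
  have hk₁' : 0 < σ₁ (β + (k + 1 : ℤ) * α : 𝓞 K) := by
    have := (div_lt_iff₀ h₁).1 (Int.lt_floor_add_one (-σ₁ β / σ₁ α))
    rw [hval]
    push_cast
    linarith
  rcases lt_or_gt_of_ne (hne' σ₂ k) with hk₂ | hk₂
  · rcases lt_or_gt_of_ne (hne' σ₂ (k + 1)) with hk₂' | hk₂'
    · exact ⟨k + 1, mul_neg_of_pos_of_neg hk₁' hk₂'⟩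
    · refine (hα.2 ⟨β + (k + 1 : ℤ) * α, -(β + k * α), ?_, ?_, by push_cast; ring⟩).elim
      · intro σ
        rcases hσ σ with rfl | rfl <;> assumption
      · intro σ
        rw [RingOfIntegers.coe_eq_algebraMap, map_neg, map_neg, ← RingOfIntegers.coe_eq_algebraMap]
        rcases hσ σ with rfl | rfl <;> linarith
  · exact ⟨k, mul_neg_of_neg_of_pos hk₁ hk₂⟩

/-- If `ω` generates the ring of integers, an indecomposable `α` is completed by some `β` of
negative norm to a `ℤ`-basis; the discriminant of the binary quadratic form `N(xα + yβ)` is then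
that of the field, namely `(σ₁ ω - σ₂ ω)²`. -/
theorem IsIndecomposableInteger.exists_norm_neg [NumberField K] {α : 𝓞 K}
    (hα : IsIndecomposableInteger α) (hσ : ∀ σ : K →+* ℝ, σ = σ₁ ∨ σ = σ₂)
    (hN : ∀ x : 𝓞 K, ((Algebra.norm ℤ x : ℤ) : ℝ) = σ₁ x * σ₂ x) {ω : 𝓞 K}
    (hω : ∀ x : 𝓞 K, ∃ u v : ℤ, x = u + v * ω) (hne : σ₁ ω - σ₂ ω ≠ 0) :
    ∃ (β : 𝓞 K) (t : ℤ), Algebra.norm ℤ β < 0 ∧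
      (t : ℝ) ^ 2 - 4 * (Algebra.norm ℤ α : ℤ) * (Algebra.norm ℤ β : ℤ) = (σ₁ ω - σ₂ ω) ^ 2 := by
  obtain ⟨u, v, huv⟩ := hω α
  have hα₀ : α ≠ 0 := by
    rintro rfl
    simpa using hα.1 σ₁
  -- `α` is primitive in the lattice, so a Bézout relation yields a complementary basis vector.
  have hcop : Int.gcd u v = 1 := by
    obtain ⟨u', hu'⟩ := Int.gcd_dvd_left (a := u) (b := v)
    obtain ⟨v', hv'⟩ := Int.gcd_dvd_right (a := u) (b := v)
    have hlt := hα.lt_two_of_eq_natCast_mul (g := Int.gcd u v) (γ := u' + v' * ω) <| by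
      calc α = (u : 𝓞 K) + v * ω := huv
        _ = (((Int.gcd u v : ℤ) * u' : ℤ) : 𝓞 K) + (((Int.gcd u v : ℤ) * v' : ℤ) : 𝓞 K) * ω := by
          rw [← hu', ← hv']
        _ = _ := by push_cast; ring
    have h0 : Int.gcd u v ≠ 0 := fun h ↦ hα₀ <| by
      obtain ⟨rfl, rfl⟩ := Int.gcd_eq_zero_iff.1 h
      simp [huv]
    omega
  obtain ⟨x, y, hxy⟩ := Int.isCoprime_iff_gcd_eq_one.2 hcop
  have hxy' : (x : ℝ) * u + y * v = 1 := by exact_mod_cast hxy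
  have hJ : ∀ k : ℤ, σ₁ α * σ₂ ((-y + x * ω) + k * α : 𝓞 K) -
      σ₂ α * σ₁ ((-y + x * ω) + k * α : 𝓞 K) = -(σ₁ ω - σ₂ ω) := fun k ↦ by
    rw [huv]
    push_cast
    simp only [map_add, map_mul, map_neg, map_intCast]
    linear_combination (-(σ₁ ω - σ₂ ω)) * hxy'
  obtain ⟨k, hk⟩ := hα.exists_add_zsmul_mul_neg hσ (β := -y + x * ω) <| by
    have := hJ 0
    simp only [Int.cast_zero, zero_mul, add_zero] at this
    rw [this]
    exact neg_ne_zero.2 hne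
  refine ⟨(-y + x * ω) + k * α,
    Algebra.norm ℤ (α + ((-y + x * ω) + k * α)) - Algebra.norm ℤ α -
      Algebra.norm ℤ ((-y + x * ω) + k * α), ?_, ?_⟩
  · rw [← hN] at hk
    exact_mod_cast hk
  · have h := hJ k
    generalize (-y + x * ω) + k * α = β at h
    have hadd : ∀ σ : K →+* ℝ, σ (α + β : 𝓞 K) = σ α + σ β := fun σ ↦ by
      push_cast
      rw [map_add]
    push_cast
    rw [hN, hN, hN, hadd, hadd, ← neg_sq (σ₁ ω - σ₂ ω), ← h]
    ring

end TwoEmbeddings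

/-! ### The numerical estimate -/

section Inequality

/-- If `a` is the least square root of `D` modulo `m` and `s - a` is another square root up to
sign, then `a ≤ s / 2`. -/
theorem two_mul_le_of_isLeast_sq {D m a s : ℕ} (hs : 0 < s)
    (ha : IsLeast {b : ℕ | b ^ 2 ≡ D [MOD m]} a)
    (h : (m : ℤ) ∣ ((a : ℤ) - s) ^ 2 - (a : ℤ) ^ 2) : 2 * a ≤ s := by
  have hmem : ((a : ℤ) - s).natAbs ∈ {b : ℕ | b ^ 2 ≡ D [MOD m]} := by
    have h1 : ((a : ℤ) - s).natAbs ^ 2 ≡ a ^ 2 [MOD m] := by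
      rw [← Int.natCast_modEq_iff]
      push_cast
      rw [sq_abs]
      exact (Int.modEq_iff_dvd.2 h).symm
    exact h1.trans ha.1
  have := ha.2 hmem
  omega

/-- The estimate for `n = N(α)` when `-M` is the norm of a basis vector complementary to `α`; here
`c = 4` for the field discriminant `D`, and `c = 1` for the field discriminant `4D`.
If `M = N`, then `t` is a square root of `D` modulo `cN`, so `a ≤ |t|` and the term `E` is not needed.
If `M > N`, then `n ≤ D / (cN)`, and `E` makes up for `a² / (cN)`. -/
theorem norm_lt_of_sq_add_eq {D N a c : ℕ} {n M t : ℤ} {E : ℝ} (hc : 0 < c) (hN : 0 < N)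
    (hn : 0 < n) (hM : (N : ℤ) ≤ M)
    (ht : t ^ 2 + c * n * M = D) (ha : IsLeast {b : ℕ | b ^ 2 ≡ D [MOD c * N]} a)
    (hE : 0 < E) (haE : (a : ℝ) ^ 2 / (c * N) < E) :
    (n : ℝ) < ((D : ℝ) - (a : ℝ) ^ 2) / (c * N) + E := by
  have hcN : (0 : ℝ) < c * N := by positivity
  have htR : (t : ℝ) ^ 2 + c * n * M = D := by exact_mod_cast ht
  rcases hM.eq_or_lt with rfl | hlt
  · have hmem : t.natAbs ∈ {b : ℕ | b ^ 2 ≡ D [MOD c * N]} := by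
      show t.natAbs ^ 2 ≡ D [MOD c * N]
      rw [← Int.natCast_modEq_iff]
      push_cast
      rw [sq_abs]
      exact Int.modEq_iff_dvd.2 ⟨n, by linarith⟩
    have hat : (a : ℤ) ^ 2 ≤ t ^ 2 := by
      rw [← Int.natAbs_sq t]
      exact_mod_cast Nat.pow_le_pow_left (ha.2 hmem) 2
    have hat' : (a : ℝ) ^ 2 ≤ (t : ℝ) ^ 2 := by exact_mod_cast hat
    have : (n : ℝ) ≤ ((D : ℝ) - (a : ℝ) ^ 2) / (c * N) := by
      rw [le_div_iff₀ hcN]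
      push_cast at htR
      linarith
    linarith
  · have hle : (n : ℝ) ≤ D / (c * N) := by
      rw [le_div_iff₀ hcN]
      have h1 : (N : ℝ) ≤ M := by exact_mod_cast hM
      have h2 : (0 : ℝ) < c * n := by
        have : (0 : ℝ) < n := by exact_mod_cast hn
        positivity
      nlinarith [sq_nonneg (t : ℝ), mul_le_mul_of_nonneg_left h1 h2.le]
    rw [sub_div]
    linarith

end Inequality

/-! ### The field `ℚ(√D)` and its integers -/

section QSqrt

variable {D : ℕ}

namespace QSqrt

/-- The element `√D` of `ℚ(√D)`. -/
noncomputable def sqrtD (D : ℕ) : QSqrt D := IntermediateField.AdjoinSimple.gen ℚ (Real.sqrt (D : ℝ))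

theorem coe_sqrtD : ((sqrtD D : QSqrt D) : ℝ) = Real.sqrt D :=
  IntermediateField.AdjoinSimple.coe_gen ℚ _

theorem sqrtD_mul_self : sqrtD D * sqrtD D = D := by
  apply Subtype.ext
  push_cast
  rw [coe_sqrtD, Real.mul_self_sqrt (Nat.cast_nonneg D)]

/-- `1` and `√D` span `ℚ(√D)`, and `D` is not a rational square; hence `ℚ(√D)` is the quadratic
algebra `ℚ[X]/(X² - D)`. -/
theorem exists_algEquiv (hD : 1 < D) (hsq : Squarefree D) :
    ∃ e : QuadraticAlgebra ℚ (D : ℚ) 0 ≃ₐ[ℚ] QSqrt D, ∀ z, e z = z.re + z.im * sqrtD D := by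
  have hirr : Irrational (Real.sqrt D) := by
    rw [irrational_sqrt_natCast_iff]
    intro hs
    obtain ⟨r, hr⟩ := hs
    have := hsq r ⟨1, by rw [mul_one]; exact hr⟩
    rw [Nat.isUnit_iff] at this
    subst this
    omega
  have : Fact (∀ r : ℚ, r ^ 2 ≠ (D : ℚ) + 0 * r) := ⟨fun r hr ↦ hirr <| by
    have h1 : (r : ℝ) ^ 2 = D := by
      have : r ^ 2 = D := by linarith
      exact_mod_cast this
    refine ⟨|r|, ?_⟩
    rw [← h1, Real.sqrt_sq_eq_abs]
    push_cast
    rfl⟩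
  let f : QuadraticAlgebra ℚ (D : ℚ) 0 →ₐ[ℚ] QSqrt D :=
    QuadraticAlgebra.lift ⟨sqrtD D, by simp [sqrtD_mul_self, Algebra.smul_def]⟩
  have hf : ∀ z, f z = z.re + z.im * sqrtD D := fun z ↦ by
    change z.re • (1 : QSqrt D) + z.im • sqrtD D = _
    rw [Algebra.smul_def, Algebra.smul_def, eq_ratCast, eq_ratCast, mul_one]
  have hsurj : Function.Surjective f := by
    have htop : QSqrt D ≤ ((QSqrt D).val.comp f).fieldRange := by
      rw [IntermediateField.adjoin_simple_le_iff]
      refine ⟨⟨0, 1⟩, ?_⟩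
      change ((f ⟨0, 1⟩ : QSqrt D) : ℝ) = _
      simp [hf, coe_sqrtD]
    intro x
    obtain ⟨z, hz⟩ := htop x.2
    exact ⟨z, Subtype.ext hz⟩
  exact ⟨AlgEquiv.ofBijective f ⟨f.toRingHom.injective, hsurj⟩, hf⟩

theorem exists_eq (hD : 1 < D) (hsq : Squarefree D) (x : QSqrt D) :
    ∃ p q : ℚ, x = p + q * sqrtD D := by
  obtain ⟨e, he⟩ := exists_algEquiv hD hsq
  exact ⟨(e.symm x).re, (e.symm x).im, by rw [← he, e.apply_symm_apply]⟩

theorem norm_eq (hD : 1 < D) (hsq : Squarefree D) (p q : ℚ) :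
    Algebra.norm ℚ ((p : QSqrt D) + q * sqrtD D) = p ^ 2 - D * q ^ 2 := by
  obtain ⟨e, he⟩ := exists_algEquiv hD hsq
  have h := Algebra.norm_eq_of_algEquiv e ⟨p, q⟩
  rw [he] at h
  rw [h, Algebra.norm_apply]
  refine (QuadraticAlgebra.det_toLinearMap_eq_norm (⟨p, q⟩ : QuadraticAlgebra ℚ (D : ℚ) 0)).trans ?_
  rw [QuadraticAlgebra.norm_def]
  ring

/-- The conjugate embedding `√D ↦ -√D`. -/
theorem exists_conj (hD : 1 < D) (hsq : Squarefree D) :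
    ∃ τ : QSqrt D →+* ℝ, τ (sqrtD D) = -Real.sqrt D := by
  obtain ⟨e, he⟩ := exists_algEquiv hD hsq
  let g : QuadraticAlgebra ℚ (D : ℚ) 0 →ₐ[ℚ] ℝ :=
    QuadraticAlgebra.lift ⟨-Real.sqrt D, by simp [Algebra.smul_def]⟩
  refine ⟨(g.comp e.symm.toAlgHom).toRingHom, ?_⟩
  have : e.symm (sqrtD D) = ⟨0, 1⟩ := by
    rw [AlgEquiv.symm_apply_eq, he]
    simp
  change g (e.symm (sqrtD D)) = _
  rw [this]
  change (0 : ℚ) • (1 : ℝ) + (1 : ℚ) • (-Real.sqrt D) = _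
  simp

theorem ringHom_apply (σ : QSqrt D →+* ℝ) (p q : ℚ) :
    σ (p + q * sqrtD D) = p + q * σ (sqrtD D) := by simp

theorem ringHom_eq_or (hD : 1 < D) (hsq : Squarefree D) {τ : QSqrt D →+* ℝ}
    (hτ : τ (sqrtD D) = -Real.sqrt D) (σ : QSqrt D →+* ℝ) :
    σ = (QSqrt D).val.toRingHom ∨ σ = τ := by
  have hs : σ (sqrtD D) * σ (sqrtD D) = Real.sqrt D * Real.sqrt D := by
    rw [← map_mul, sqrtD_mul_self, map_natCast, Real.mul_self_sqrt (Nat.cast_nonneg D)]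
  rcases mul_self_eq_mul_self_iff.1 hs with h | h
  · left
    ext x
    obtain ⟨p, q, rfl⟩ := exists_eq hD hsq x
    rw [ringHom_apply, ringHom_apply, h]
    simp [coe_sqrtD]
  · right
    ext x
    obtain ⟨p, q, rfl⟩ := exists_eq hD hsq x
    rw [ringHom_apply, ringHom_apply, h, hτ]

theorem norm_int_eq_mul (hD : 1 < D) (hsq : Squarefree D) {τ : QSqrt D →+* ℝ}
    (hτ : τ (sqrtD D) = -Real.sqrt D) (x : 𝓞 (QSqrt D)) :
    ((Algebra.norm ℤ x : ℤ) : ℝ) = (QSqrt D).val.toRingHom x * τ x := by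
  obtain ⟨p, q, hx⟩ := exists_eq hD hsq (x : QSqrt D)
  have h : ((Algebra.norm ℤ x : ℤ) : ℚ) = p ^ 2 - D * q ^ 2 := by
    rw [Algebra.coe_norm_int, hx, norm_eq hD hsq]
  have h' : ((Algebra.norm ℤ x : ℤ) : ℝ) = (p : ℝ) ^ 2 - D * (q : ℝ) ^ 2 := by exact_mod_cast h
  have hv : (QSqrt D).val.toRingHom (sqrtD D) = Real.sqrt D := coe_sqrtD
  rw [h', hx, ringHom_apply, ringHom_apply, hτ, hv]
  linear_combination (q : ℝ) ^ 2 * Real.mul_self_sqrt (Nat.cast_nonneg (α := ℝ) D)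

/-- A rational number `r` with `D r²` integral is an integer, for `D` squarefree. -/
theorem exists_intCast_eq_of_squarefree_mul_sq (hsq : Squarefree D) {r : ℚ} {k : ℤ}
    (h : (D : ℚ) * r ^ 2 = k) : ∃ v : ℤ, r = v := by
  have hD : (D : ℚ) ≠ 0 := by exact_mod_cast hsq.ne_zero
  obtain ⟨w, hw⟩ : ∃ w : ℤ, (w : ℚ) = D * r := by
    have hint : IsIntegral ℤ ((D : ℚ) * r) := by
      refine IsIntegral.of_pow (n := 2) (by norm_num) ?_
      have : ((D : ℚ) * r) ^ 2 = algebraMap ℤ ℚ (D * k) := by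
        simp only [algebraMap_int_eq, eq_intCast]
        push_cast
        linear_combination (D : ℚ) * h
      rw [this]
      exact isIntegral_algebraMap
    simpa using IsIntegrallyClosed.isIntegral_iff.1 hint
  have hw2 : w ^ 2 = D * k := by
    have : (w : ℚ) ^ 2 = D * k := by rw [hw]; linear_combination (D : ℚ) * h
    exact_mod_cast this
  have hsqZ : Squarefree (D : ℤ) := by exact_mod_cast (Int.squarefree_natCast.2 hsq)
  obtain ⟨v, hv⟩ := (hsqZ.dvd_pow_iff_dvd two_ne_zero).1 ⟨k, hw2⟩
  refine ⟨v, mul_left_cancel₀ hD ?_⟩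
  rw [← hw, hv]
  push_cast
  rfl

/-- Integers of `ℚ(√D)` are of the form `(u + v√D)/2`. The trace `u` is read off from
`N(x + 1) - N(x) = Tr(x) + 1`. -/
theorem exists_half_integers (hD : 1 < D) (hsq : Squarefree D) (x : 𝓞 (QSqrt D)) :
    ∃ u v : ℤ, (2 * x : QSqrt D) = u + v * sqrtD D ∧ (4 : ℤ) ∣ u ^ 2 - D * v ^ 2 := by
  obtain ⟨p, q, hx⟩ := exists_eq hD hsq (x : QSqrt D)
  have h : ((Algebra.norm ℤ x : ℤ) : ℚ) = p ^ 2 - D * q ^ 2 := by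
    rw [Algebra.coe_norm_int, hx, norm_eq hD hsq]
  have h1 : ((Algebra.norm ℤ (x + 1) : ℤ) : ℚ) = (p + 1) ^ 2 - D * q ^ 2 := by
    rw [Algebra.coe_norm_int, ← norm_eq hD hsq]
    rw [RingOfIntegers.coe_eq_algebraMap, map_add, map_one, ← RingOfIntegers.coe_eq_algebraMap, hx]
    congr 1
    push_cast
    ring
  generalize Algebra.norm ℤ x = n at h
  generalize Algebra.norm ℤ (x + 1) = m at h1
  have hu : 2 * p = ((m - n - 1 : ℤ) : ℚ) := by
    push_cast
    linarith
  set u := m - n - 1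
  obtain ⟨v, hv⟩ := exists_intCast_eq_of_squarefree_mul_sq hsq (r := 2 * q) (k := u ^ 2 - 4 * n) <| by
    push_cast
    rw [← hu]
    linarith
  refine ⟨u, v, ?_, n, ?_⟩
  · rw [hx, ← Rat.cast_intCast u, ← Rat.cast_intCast v, ← hu, ← hv]
    push_cast
    ring
  · have : (u : ℚ) ^ 2 - D * (v : ℚ) ^ 2 = 4 * n := by
      rw [← hu, ← hv]
      linarith
    exact_mod_cast this

/-- For `D ≡ 1 (mod 4)`, `(1 + √D)/2` generates the ring of integers. -/
theorem exists_generator_of_one (hD : 1 < D) (hsq : Squarefree D) (h4 : D % 4 = 1) :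
    ∃ ω : 𝓞 (QSqrt D), (2 * ω : QSqrt D) = 1 + sqrtD D ∧ ∀ x, ∃ u v : ℤ, x = u + v * ω := by
  have hint : IsIntegral ℤ ((1 + sqrtD D) / 2) := by
    obtain ⟨m, hm⟩ : ∃ m, D = 4 * m + 1 := ⟨D / 4, by omega⟩
    refine ⟨Polynomial.X ^ 2 - Polynomial.X - Polynomial.C (m : ℤ), by monicity!, ?_⟩
    have h := sqrtD_mul_self (D := D)
    have h' : (D : QSqrt D) = 4 * m + 1 := by
      exact_mod_cast congrArg (Nat.cast : ℕ → QSqrt D) hm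
    rw [h'] at h
    simp
    linear_combination h / 4
  obtain ⟨ω, hω⟩ : ∃ ω : 𝓞 (QSqrt D), (ω : QSqrt D) = (1 + sqrtD D) / 2 := ⟨⟨_, hint⟩, rfl⟩
  refine ⟨ω, ?_, fun x ↦ ?_⟩
  · rw [hω]
    ring
  · obtain ⟨u, v, hx, hdvd⟩ := exists_half_integers hD hsq x
    have hpar : (2 : ℤ) ∣ u - v := by
      have hD4 : (D : ZMod 4) = 1 := by simpa [h4] using (ZMod.natCast_mod D 4).symm
      have h := (ZMod.intCast_zmod_eq_zero_iff_dvd _ 4).2 hdvd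
      push_cast at h
      rw [hD4] at h
      have key : ∀ a b : ZMod 4, a ^ 2 - 1 * b ^ 2 = 0 → 2 * (a - b) = 0 := by decide
      have h2 : ((2 * (u - v) : ℤ) : ZMod 4) = 0 := by
        push_cast
        exact key u v h
      have := (ZMod.intCast_zmod_eq_zero_iff_dvd _ 4).1 h2
      omega
    obtain ⟨w, hw⟩ := hpar
    refine ⟨w, v, RingOfIntegers.ext ?_⟩
    simp only [RingOfIntegers.coe_eq_algebraMap, map_add, map_mul, map_intCast] at hω hx ⊢
    rw [hω]
    have hw' : (u : QSqrt D) - v = 2 * w := by exact_mod_cast congrArg (Int.cast : ℤ → QSqrt D) hw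
    linear_combination hx / 2 + hw' / 2

/-- For `D ≡ 2, 3 (mod 4)`, `√D` generates the ring of integers. -/
theorem exists_generator_of_two_or_three (hD : 1 < D) (hsq : Squarefree D)
    (h4 : D % 4 = 2 ∨ D % 4 = 3) (ω : 𝓞 (QSqrt D)) (hω : (ω : QSqrt D) = sqrtD D)
    (x : 𝓞 (QSqrt D)) : ∃ u v : ℤ, x = u + v * ω := by
  obtain ⟨u, v, hx, hdvd⟩ := exists_half_integers hD hsq x
  have hpar : (2 : ℤ) ∣ u ∧ (2 : ℤ) ∣ v := by
    have hD4 : (D : ZMod 4) = 2 ∨ (D : ZMod 4) = 3 := by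
      rw [← ZMod.natCast_mod D 4]
      exact h4.imp (fun h ↦ by rw [h]; rfl) (fun h ↦ by rw [h]; rfl)
    have h := (ZMod.intCast_zmod_eq_zero_iff_dvd _ 4).2 hdvd
    push_cast at h
    have key : ∀ d : ZMod 4, d = 2 ∨ d = 3 → ∀ a b : ZMod 4, a ^ 2 - d * b ^ 2 = 0 →
        2 * a = 0 ∧ 2 * b = 0 := by decide
    obtain ⟨hu, hv⟩ := key D hD4 u v h
    have hu' : ((2 * u : ℤ) : ZMod 4) = 0 := by
      push_cast
      exact hu
    have hv' : ((2 * v : ℤ) : ZMod 4) = 0 := by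
      push_cast
      exact hv
    have := (ZMod.intCast_zmod_eq_zero_iff_dvd _ 4).1 hu'
    have := (ZMod.intCast_zmod_eq_zero_iff_dvd _ 4).1 hv'
    omega
  obtain ⟨⟨y, hy⟩, z, hz⟩ := hpar
  refine ⟨y, z, RingOfIntegers.ext ?_⟩
  simp only [RingOfIntegers.coe_eq_algebraMap, map_add, map_mul, map_intCast] at hω hx ⊢
  rw [hω]
  have hy' : (u : QSqrt D) = 2 * y := by exact_mod_cast congrArg (Int.cast : ℤ → QSqrt D) hy
  have hz' : (v : QSqrt D) = 2 * z := by exact_mod_cast congrArg (Int.cast : ℤ → QSqrt D) hz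
  linear_combination hx / 2 + hy' / 2 + hz' * sqrtD D / 2

theorem exists_coe_eq_sqrtD : ∃ ω : 𝓞 (QSqrt D), (ω : QSqrt D) = sqrtD D := by
  have hint : IsIntegral ℤ (sqrtD D) := by
    refine IsIntegral.of_pow (n := 2) (by norm_num) ?_
    rw [sq, sqrtD_mul_self, ← map_natCast (algebraMap ℤ (QSqrt D))]
    exact isIntegral_algebraMap
  exact ⟨⟨_, hint⟩, rfl⟩

/-- The element `⌊√D⌋ + √D` has norm in `[-2√D, 0)`. -/
theorem le_two_mul_sqrt_of_isGreatest (hD : 1 < D) (hsq : Squarefree D) {N : ℕ}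
    (hN : IsGreatest (negativeNorms (QSqrt D)) (-(N : ℤ))) : (N : ℝ) ≤ 2 * Real.sqrt D := by
  have hle := Nat.sqrt_le' D
  have hge := Nat.sqrt_le_add D
  have hne : Nat.sqrt D ^ 2 ≠ D := fun h ↦ by
    have := hsq (Nat.sqrt D) ⟨1, by rw [mul_one, ← sq, h]⟩
    rw [Nat.isUnit_iff] at this
    rw [this] at h
    omega
  have hmem : ((Nat.sqrt D ^ 2 : ℕ) : ℤ) - D ∈ negativeNorms (QSqrt D) := by
    obtain ⟨ω, hω⟩ := exists_coe_eq_sqrtD (D := D)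
    refine ⟨by omega, Nat.sqrt D + ω, ?_⟩
    have h : ((Algebra.norm ℤ (Nat.sqrt D + ω) : ℤ) : ℚ) = (Nat.sqrt D : ℚ) ^ 2 - D * 1 ^ 2 := by
      rw [Algebra.coe_norm_int, ← norm_eq hD hsq]
      simp only [RingOfIntegers.coe_eq_algebraMap, map_add, map_natCast] at hω ⊢
      rw [hω, Rat.cast_natCast, Rat.cast_one, one_mul]
    have h' : ((Algebra.norm ℤ (Nat.sqrt D + ω) : ℤ) : ℚ) = ((Nat.sqrt D ^ 2 : ℕ) - D : ℤ) := by
      rw [h]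
      push_cast
      ring
    exact_mod_cast h'
  have h1 := hN.2 hmem
  have h2 : N ≤ 2 * Nat.sqrt D := by
    rw [← sq] at hge
    push_cast at h1
    zify at hge ⊢
    linarith
  calc (N : ℝ) ≤ 2 * (Nat.sqrt D : ℝ) := by exact_mod_cast h2
    _ ≤ 2 * Real.sqrt D := by gcongr; exact Real.nat_sqrt_le_real_sqrt

end QSqrt

end QSqrt

/-! ### The bound on the norm -/

theorem theorem2 (D : ℕ) (hD : 1 < D) (hsq : Squarefree D)
    (N : ℕ) (hN : IsGreatest (negativeNorms (QSqrt D)) (-(N : ℤ))) (a : ℕ) :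
    (D ≡ 1 [MOD 4] →
      IsLeast {b : ℕ | b ^ 2 ≡ D [MOD 4 * N]} a →
      ∀ α : 𝓞 (QSqrt D), IsIndecomposableInteger α →
        ((Algebra.norm ℤ α : ℤ) : ℝ) <
          ((D : ℝ) - (a : ℝ) ^ 2) / (4 * (N : ℝ)) + Real.sqrt (D : ℝ)) ∧
    ((D ≡ 2 [MOD 4] ∨ D ≡ 3 [MOD 4]) →
      IsLeast {b : ℕ | b ^ 2 ≡ D [MOD N]} a →
      ∀ α : 𝓞 (QSqrt D), IsIndecomposableInteger α →
        ((Algebra.norm ℤ α : ℤ) : ℝ) <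
          ((D : ℝ) - (a : ℝ) ^ 2) / (N : ℝ) + 2 * Real.sqrt (D : ℝ)) := by
  obtain ⟨τ, hτ⟩ := QSqrt.exists_conj hD hsq
  have hσ := QSqrt.ringHom_eq_or hD hsq hτ
  have hnorm := QSqrt.norm_int_eq_mul hD hsq hτ
  have hval : (QSqrt D).val.toRingHom (QSqrt.sqrtD D) = Real.sqrt D := QSqrt.coe_sqrtD
  have hNle := QSqrt.le_two_mul_sqrt_of_isGreatest hD hsq hN
  have hNpos : 0 < N := by
    have := hN.1.1
    omega
  have hNR : (0 : ℝ) < N := by exact_mod_cast hNpos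
  have hsqrt : 0 < Real.sqrt D := Real.sqrt_pos.2 (by positivity)
  have hsqrt2 := Real.mul_self_sqrt (Nat.cast_nonneg (α := ℝ) D)
  have hpos : ∀ α : 𝓞 (QSqrt D), IsIndecomposableInteger α → 0 < Algebra.norm ℤ α := fun α hα ↦ by
    have := mul_pos (hα.1 (QSqrt D).val.toRingHom) (hα.1 τ)
    rw [← hnorm] at this
    exact_mod_cast this
  have hneg : ∀ β : 𝓞 (QSqrt D), Algebra.norm ℤ β < 0 → (N : ℤ) ≤ -Algebra.norm ℤ β :=
    fun β hβ ↦ by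
      have := hN.2 ⟨hβ, β, rfl⟩
      omega
  constructor
  · intro hD4 ha α hα
    obtain ⟨ω, hω, hgen⟩ := QSqrt.exists_generator_of_one hD hsq hD4
    have hdiff : (QSqrt D).val.toRingHom ω - τ ω = Real.sqrt D := by
      have h₁ := congrArg (QSqrt D).val.toRingHom hω
      have h₂ := congrArg τ hω
      simp only [map_mul, map_add, map_one, map_ofNat] at h₁ h₂
      rw [hval] at h₁
      rw [hτ] at h₂
      linarith
    obtain ⟨β, t, hβ, ht⟩ := hα.exists_norm_neg hσ hnorm hgen (hdiff ▸ hsqrt.ne')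
    rw [hdiff, sq (Real.sqrt D), hsqrt2] at ht
    have ht' : t ^ 2 + (4 : ℕ) * Algebra.norm ℤ α * (-Algebra.norm ℤ β) = D := by
      have : t ^ 2 - 4 * Algebra.norm ℤ α * Algebra.norm ℤ β = D := by exact_mod_cast ht
      push_cast
      linarith
    -- The residue of `b ^ 2` modulo `4 * N` depends only on `b` modulo `2 * N`.
    have haN := two_mul_le_of_isLeast_sq (s := 2 * N) (by omega) ha ⟨N - a, by push_cast; ring⟩
    have haN' : (a : ℝ) ≤ N := by exact_mod_cast (by omega : a ≤ N)
    have h := norm_lt_of_sq_add_eq (by norm_num) hNpos (hpos α hα) (hneg β hβ) ht' ha hsqrt <| by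
      rw [div_lt_iff₀ (by positivity)]
      push_cast
      nlinarith [Nat.cast_nonneg (α := ℝ) a]
    exact_mod_cast h
  · intro hD4 ha α hα
    obtain ⟨ω, hω⟩ := QSqrt.exists_coe_eq_sqrtD (D := D)
    have hgen := QSqrt.exists_generator_of_two_or_three hD hsq hD4 ω hω
    have hdiff : (QSqrt D).val.toRingHom ω - τ ω = 2 * Real.sqrt D := by
      rw [hω, hval, hτ]
      ring
    obtain ⟨β, t, hβ, ht⟩ := hα.exists_norm_neg hσ hnorm hgen (hdiff ▸ by positivity)
    rw [hdiff, mul_pow, sq (Real.sqrt D), hsqrt2] at ht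
    have ht' : t ^ 2 - 4 * Algebra.norm ℤ α * Algebra.norm ℤ β = 2 ^ 2 * D := by exact_mod_cast ht
    -- The discriminant is `4 * D`, so the middle coefficient `t` is even.
    obtain ⟨y, rfl⟩ : (2 : ℤ) ∣ t := Int.prime_two.dvd_of_dvd_pow (n := 2)
      ⟨2 * Algebra.norm ℤ α * Algebra.norm ℤ β + 2 * D, by linarith⟩
    have hy : y ^ 2 + (1 : ℕ) * Algebra.norm ℤ α * (-Algebra.norm ℤ β) = D := by
      push_cast
      linarith
    have ha' : IsLeast {b : ℕ | b ^ 2 ≡ D [MOD 1 * N]} a := by rwa [one_mul]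
    have haN := two_mul_le_of_isLeast_sq (s := N) hNpos ha ⟨N - 2 * a, by ring⟩
    have haN' : 2 * (a : ℝ) ≤ N := by exact_mod_cast haN
    have h := norm_lt_of_sq_add_eq (E := 2 * Real.sqrt D) one_pos hNpos (hpos α hα) (hneg β hβ) hy
      ha' (by positivity) <| by
      rw [div_lt_iff₀ (by positivity)]
      push_cast
      nlinarith [Nat.cast_nonneg (α := ℝ) a]
    simpa only [Nat.cast_one, one_mul] using h
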